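/- Let $T$ be the binary rooted tree, whose vertices are the finite words over $\{0,1\}$, and let $\mathrm{Aut}(T)\simeq(\mathrm{Aut}(T)\times\mathrm{Aut}(T))\rtimes S_2$ be the wreath recursion. For a sequence $\omega=\omega_0\omega_1\omega_2\dots\in\{0,1,2\}^{\mathbb N}$ with shift $\sigma\omega=\omega_1\omega_2\dots$, let $G_\omega=\langle a,b_\omega,c_\omega,d_\omega\rangle\le\mathrm{Aut}(T)$, where $a$ exchanges the two subtrees below the root and, recursively, $v_\omega=(u^v(\omega_0),v_{\sigma\omega})$ for $v\in\{b,c,d\}$, with $$\big(u^b(0),u^b(1),u^b(2)\big)=(a,a,\mathrm{id}),\quad \big(u^c(0),u^c(1),u^c(2)\big)=(a,\mathrm{id},a),\quad \big(u^d(0),u^d(1),u^d(2)\big)=(\mathrm{id},a,a).$$ Let $\rho=1^\infty\in\partial T$ and let $X=\rho G_\omega$ be its orbit. For a finite group $F$ let $\Gamma_\omega=F\wr_X G_\omega=\big(\bigoplus_X F\big)\rtimes G_\omega$ be the permutational wreath product, generated by the finite set $$S_\omega=\{a\}\cup\{\varphi_f v : f\in F,\ v\in\{\mathrm{id},b_\omega,c_\omega,d_\omega\}\},$$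 where $\varphi_f:X\to F$ takes the value $f$ at $\rho$ and is trivial elsewhere. Let $b_{\Gamma_\omega}(r)=|S_\omega^r|$, for $r\in\mathbb N$, be the growth function of $\Gamma_\omega$ with respect to $S_\omega$. Call $\omega$ rotating if $\omega_{i+1}\in\{\omega_i,\omega_i+1\}$ mod $3$ for all $i$, and for $p\ge1$ let $q(\omega_i,\dots,\omega_{i+p})$ be the number of $j\in\{i,\dots,i+p-1\}$ with $\omega_{j+1}=\omega_j+1$ mod $3$ (the rotation steps on $[i,i+p]$). Let $\eta$ be the real root of $x^3+x^2+x-2$. There is a constant $A>0$, depending only on the cardinality of $F$, such that for every rotating sequence $\omega$ the following hold. (1) Let $P$ be a natural number and $\lambda\ge 0$ a real number such that for every $i\ge0$ there is an integer $p(i)$ with $1\le p(i)\le P$ and $$\frac{q(\omega_i,\dots,\omega_{i+p(i)})}{p(i)}\ge\lambda .$$ Then for all $r\in\mathbb N$ $$\log b_{\Gamma_\omega}(r)\le A^P r^\alpha,\qquad \alpha=\frac{\log 2}{\log 2-\lambda\log\eta}.$$ (2) In particular, if $\omega$ is $p$-periodic for some $p\ge1$ and $q=q(\omega_0,\dots,\omega_p)$,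 then for all $r\in\mathbb N$ $$\log b_{\Gamma_\omega}(r)\le A^p r^\alpha,\qquad \alpha=\frac{\log 2}{\log 2-\frac qp\log\eta}.$$ -/

import Mathlib

open scoped Pointwise

namespace WreathGrowth

/-! ### The binary rooted tree and its boundary -/

/-- The boundary of the binary rooted tree: infinite sequences of letters `0 = false`, `1 = true`.
A rooted tree automorphism is determined by the permutation it induces on the boundary. -/
abbrev Boundary : Type := ℕ → Bool

/-- The shift `σ` on sequences. -/
def shift {A : Type*} (x : ℕ → A) : ℕ → A := fun n => x (n + 1)

/-- The rightmost ray `ρ = 1^∞`. -/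
def ray : Boundary := fun _ => true

/-- The group `Aut(T)` of automorphisms of the binary rooted tree, seen as permutations of the
boundary: two rays share their first `n` letters if and only if their images do. -/
def treeAut : Subgroup (Equiv.Perm Boundary) where
  carrier := {g | ∀ (x y : Boundary) (n : ℕ),
    (∀ i < n, g x i = g y i) ↔ (∀ i < n, x i = y i)}
  one_mem' := fun _ _ _ => Iff.rfl
  mul_mem' := fun {g h} hg hh x y n => (hg (h x) (h y) n).trans (hh x y n)
  inv_mem' := fun {g} hg x y n => by simpa using (hg (g⁻¹ x) (g⁻¹ y) n).symm

/-- The map underlying `a = (1,1)ε`: it exchanges the two subtrees of the root. -/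
def rootFlip (x : Boundary) : Boundary
  | 0 => !(x 0)
  | n + 1 => x (n + 1)

/-- Names of the three directed generators. -/
inductive Letter
  | b
  | c
  | d

/-- The table `u^b, u^c, u^d`: `true` stands for `a`, `false` for the identity. -/
def Letter.isFlip : Letter → ZMod 3 → Bool
  | .b, i => decide (i = 0 ∨ i = 1)
  | .c, i => decide (i = 0 ∨ i = 2)
  | .d, i => decide (i = 1 ∨ i = 2)

/-- The map underlying `v_ω = (u^v(ω₀), v_{σω})`: on the subtree below `0` it acts as
`u^v(ω₀) ∈ {id, a}`, on the subtree below `1` as `v_{σω}`. -/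
def directed (v : Letter) : (ℕ → ZMod 3) → Boundary → Boundary
  | _, x, 0 => x 0
  | ω, x, n + 1 =>
    if x 0 = true then directed v (shift ω) (shift x) n
    else if v.isFlip (ω 0) = true then rootFlip (shift x) n
    else shift x n

theorem rootFlip_involutive : Function.Involutive rootFlip := by
  intro x
  funext n
  cases n <;> simp [rootFlip]

theorem shift_directed (v : Letter) (ω : ℕ → ZMod 3) (x : Boundary) :
    shift (directed v ω x) =
      if x 0 = true then directed v (shift ω) (shift x)
      else if v.isFlip (ω 0) = true then rootFlip (shift x) else shift x := by
  funext n
  simp only [shift, directed]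
  split_ifs <;> rfl

theorem directed_involutive (v : Letter) (ω : ℕ → ZMod 3) :
    Function.Involutive (directed v ω) := by
  intro x
  funext n
  induction n generalizing ω x with
  | zero => rfl
  | succ n ih =>
    have h0 : directed v ω x 0 = x 0 := rfl
    rw [directed, h0, shift_directed]
    by_cases hx : x 0 = true
    · simp only [hx, if_true]
      exact ih (shift ω) (shift x)
    · by_cases hu : v.isFlip (ω 0) = true
      · simp only [hx, hu, if_true]
        exact congrFun (rootFlip_involutive (shift x)) n
      · simp only [hx, hu]
        rfl

/-- The generator `a`. -/
def genA : Equiv.Perm Boundary := rootFlip_involutive.toPerm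

/-- The generators `b_ω, c_ω, d_ω`. -/
def gen (v : Letter) (ω : ℕ → ZMod 3) : Equiv.Perm Boundary := (directed_involutive v ω).toPerm

/-- The group `G_ω = ⟨a, b_ω, c_ω, d_ω⟩`. -/
def G (ω : ℕ → ZMod 3) : Subgroup (Equiv.Perm Boundary) :=
  Subgroup.closure {genA, gen .b ω, gen .c ω, gen .d ω}

/-- `G_ω` consists of automorphisms of the binary rooted tree. -/
theorem G_le_treeAut (ω : ℕ → ZMod 3) : G ω ≤ treeAut := by
  have of_half : ∀ f : Boundary → Boundary, Function.Involutive f →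
      (∀ x y n, (∀ i < n, x i = y i) → ∀ i < n, f x i = f y i) →
      ∀ x y n, (∀ i < n, f x i = f y i) ↔ (∀ i < n, x i = y i) := by
    intro f hf h x y n
    refine ⟨fun hxy => ?_, h x y n⟩
    have := h (f x) (f y) n hxy
    rwa [hf x, hf y] at this
  have hA : ∀ x y n, (∀ i < n, x i = y i) → ∀ i < n, rootFlip x i = rootFlip y i := by
    intro x y n h i hi
    cases i with
    | zero => simp [rootFlip, h 0 hi]
    | succ i => simpa [rootFlip] using h (i + 1) hi
  have hV : ∀ v ω x y n, (∀ i < n, x i = y i) →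
      ∀ i < n, directed v ω x i = directed v ω y i := by
    intro v ω x y n h i hi
    induction i generalizing ω x y n with
    | zero => exact h 0 hi
    | succ i ih =>
      have hs : ∀ j < n - 1, shift x j = shift y j := fun j hj => h (j + 1) (by omega)
      simp only [directed, h 0 (by omega), ih (shift ω) (shift x) (shift y) (n - 1) hs (by omega),
        hA (shift x) (shift y) (n - 1) hs i (by omega), hs i (by omega)]
  refine (Subgroup.closure_le _).2 ?_
  rintro g (rfl | rfl | rfl | rfl)
  · exact of_half _ rootFlip_involutive hA
  all_goals exact of_half _ (directed_involutive _ ω) (hV _ ω)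

/-! ### Permutational wreath products -/

/-- The group `Σ_X F` of finitely supported functions `X → F`. -/
def finSupp (X F : Type*) [Group F] : Subgroup (X → F) where
  carrier := {φ | (Function.mulSupport φ).Finite}
  one_mem' := by simp
  mul_mem' := fun {φ ψ} hφ hψ =>
    (Set.Finite.union hφ hψ).subset (Function.mulSupport_mul φ ψ)
  inv_mem' := fun {φ} hφ => by simpa using hφ

/-- The action of `G` on `Σ_X F` by `(g.φ)(x) = φ(x·g)`, where `x·g = g⁻¹ x` is the right action
associated to the left action of `G` on `X`. -/
def finSuppAction (G X F : Type*) [Group G] [MulAction G X] [Group F] :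
    G →* MulAut (finSupp X F) where
  toFun g :=
    { toFun := fun φ => ⟨fun x => φ.1 (g⁻¹ • x),
        Set.Finite.preimage (MulAction.injective g⁻¹).injOn φ.2⟩
      invFun := fun φ => ⟨fun x => φ.1 (g • x),
        Set.Finite.preimage (MulAction.injective g).injOn φ.2⟩
      left_inv := fun φ => by ext x; simp
      right_inv := fun φ => by ext x; simp
      map_mul' := fun φ ψ => rfl }
  map_one' := by ext φ x; simp
  map_mul' g h := by ext φ x; simp [mul_smul]

/-- The permutational wreath product `F ≀_X G = Σ_X F ⋊ G`. -/
abbrev PermWreath (F G X : Type*) [Group F] [Group G] [MulAction G X] : Type _ :=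
  finSupp X F ⋊[finSuppAction G X F] G

/-! ### The groups `Γ_ω` -/

/-- The orbit `X` of `ρ` under `G_ω`. -/
abbrev X (ω : ℕ → ZMod 3) : Type := MulAction.orbit (G ω) ray

/-- `ρ` as a point of its orbit. -/
def basePoint (ω : ℕ → ZMod 3) : X ω := ⟨ray, MulAction.mem_orbit_self ray⟩

/-- The group `Γ_ω = F ≀_X G_ω`. -/
abbrev Γ (F : Type*) [Group F] (ω : ℕ → ZMod 3) : Type _ := PermWreath F (G ω) (X ω)

open Classical in
/-- The function `φ_f` with value `f` at `ρ` and trivial elsewhere. -/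
noncomputable def delta {F : Type*} [Group F] (ω : ℕ → ZMod 3) (f : F) : finSupp (X ω) F :=
  ⟨Pi.mulSingle (basePoint ω) f, (Set.finite_singleton (basePoint ω)).subset
    Pi.mulSupport_mulSingle_subset⟩

/-- The generating set `S_ω = {a} ⊔ {φ_f v | v ∈ {id, b_ω, c_ω, d_ω}, f ∈ F}` of `Γ_ω`. -/
def genSet (F : Type*) [Group F] (ω : ℕ → ZMod 3) : Set (Γ F ω) :=
  {γ | γ.left = 1 ∧ (γ.right : Equiv.Perm Boundary) = genA} ∪
  {γ | ∃ f : F, γ.left = delta ω f ∧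
    (γ.right : Equiv.Perm Boundary) ∈
      ({1, gen .b ω, gen .c ω, gen .d ω} : Set (Equiv.Perm Boundary))}

/-- The growth function `b_{Γ,S}(r) = |S^r|`. -/
noncomputable def growth {Γ : Type*} [Group Γ] (S : Set Γ) (r : ℕ) : ℕ := (S ^ r).ncard

/-- The set `S_ω` is finite, so that the cardinals `|S_ω^r|` are genuine. -/
theorem genSet_pow_finite (F : Type*) [Group F] [Finite F] (ω : ℕ → ZMod 3) (r : ℕ) :
    (genSet F ω ^ r).Finite := by
  suffices h : (genSet F ω).Finite by
    induction r with
    | zero => simp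
    | succ r ih => exact pow_succ (genSet F ω) r ▸ ih.mul h
  have hL : (Set.insert 1 (Set.range (delta (F := F) ω))).Finite :=
    (Set.finite_range _).insert _
  have hR : ({genA, 1, gen .b ω, gen .c ω, gen .d ω} : Set (Equiv.Perm Boundary)).Finite :=
    Set.toFinite _
  refine ((hL.prod hR).preimage (f := fun γ : Γ F ω => (γ.left, (γ.right : Equiv.Perm Boundary)))
    ?_).subset ?_
  · rintro γ - γ' - h
    simp only [Prod.mk.injEq] at h
    exact SemidirectProduct.ext h.1 (Subtype.ext h.2)
  · rintro γ (⟨h1, h2⟩ | ⟨f, h1, h2⟩)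
    · exact ⟨Or.inl h1, Or.inl h2⟩
    · exact ⟨Or.inr ⟨f, h1.symm⟩, Or.inr h2⟩

/-! ### Rotating sequences -/

/-- `ω` is rotating if `ω_{i+1} ∈ {ω_i, ω_i + 1}` mod 3 for all `i`. -/
def IsRotating (ω : ℕ → ZMod 3) : Prop := ∀ i, ω (i + 1) = ω i ∨ ω (i + 1) = ω i + 1

/-- The number `q(ω_i, …, ω_{i+p})` of rotation steps on `[i, i+p]`. -/
def rotSteps (ω : ℕ → ZMod 3) (i p : ℕ) : ℕ :=
  ((Finset.Ico i (i + p)).filter fun j => ω (j + 1) = ω j + 1).card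

end WreathGrowth

/-! `Γ_ω` acts faithfully on `∂T × F` (`rep_injective`), so `|S^r|` is bounded by counting the maps
that arise. Each is a word `h₀ a h₁ a ⋯ a h_k` whose syllables `h_i = φ_f v` multiply as in `F ×
Klein`. Its sections below `0` and `1` are again such words, over `σω`.

A letter `a` weighs 1, and `v` has a weight depending on the phase `ω₀`. The two sections together
weigh at most `κ * (weight + 1)` (`exists_sections`), with `κ = η` at a rotation step and `κ = 1`
otherwise. The cubic for `η` makes a single choice of weights contract by exactly `η` on all three
nontrivial `v`. After `n` levels with `q` rotation steps the total weight is at most `η^q * 2r +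
O(2^n)`.

The map is recovered from the root permutations on the first `n` levels and the words on level `n`,
that is, from a string of about that length over `8|F|` symbols (`exists_code`, `growth_le_pow`).
Hence `log b(r)` is at most a constant times `η^q r + 2^n`. With `q ≥ λn` the two terms balance at
`2^n = r^α`; reaching a level where `q ≥ λn` costs fewer than `P` further levels (`exists_level`),
hence a factor at most `2^P`. -/

namespace WreathGrowth

/-! ### The directed automorphisms indexed by the Klein group -/

/-- The Klein group `{id, b, c, d}`; an element is determined by its table at `0` and `1`. -/
abbrev Klein : Type := Bool × Bool

/-- The table of an element of the Klein group: `true` stands for `a`, `false` for the identity. -/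
def Klein.flip (v : Klein) (i : ZMod 3) : Bool :=
  if i = 0 then v.1 else if i = 1 then v.2 else xor v.1 v.2

/-- The multiplication of the Klein group. -/
def Klein.mul (v w : Klein) : Klein := (xor v.1 w.1, xor v.2 w.2)

theorem Klein.flip_mul (v w : Klein) (i : ZMod 3) :
    (v.mul w).flip i = xor (v.flip i) (w.flip i) := by
  revert v w i; decide

/-- The three table entries of `v` sum to zero mod 2, so the entries at two consecutive phases
determine the third; weights therefore need only two of them. -/
theorem Klein.flip_add_two (v : Klein) (i : ZMod 3) :
    v.flip (i + 1 + 1) = xor (v.flip i) (v.flip (i + 1)) := by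
  revert v i; decide

/-- The directed automorphism attached to an element of the Klein group. -/
def dir (v : Klein) : (ℕ → ZMod 3) → Boundary → Boundary
  | _, x, 0 => x 0
  | ω, x, n + 1 =>
    if x 0 = true then dir v (shift ω) (shift x) n
    else if v.flip (ω 0) = true then rootFlip (shift x) n
    else shift x n

theorem shift_dir (v : Klein) (ω : ℕ → ZMod 3) (x : Boundary) :
    shift (dir v ω x) =
      if x 0 = true then dir v (shift ω) (shift x)
      else if v.flip (ω 0) = true then rootFlip (shift x) else shift x := by
  funext n
  simp only [shift, dir]
  split_ifs <;> rfl

theorem dir_dir (v w : Klein) (ω : ℕ → ZMod 3) (x : Boundary) :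
    dir v ω (dir w ω x) = dir (v.mul w) ω x := by
  funext n
  induction n generalizing ω x with
  | zero => rfl
  | succ n ih =>
    have h0 : dir w ω x 0 = x 0 := rfl
    rw [dir, h0, shift_dir, dir, Klein.flip_mul]
    by_cases hx : x 0 = true
    · simp only [hx, if_true]
      exact ih (shift ω) (shift x)
    · cases hv : v.flip (ω 0) <;> cases hw : w.flip (ω 0) <;> simp [hx, rootFlip_involutive _]

theorem directed_eq_dir {l : Letter} {v : Klein} (h : ∀ i, l.isFlip i = v.flip i)
    (ω : ℕ → ZMod 3) : directed l ω = dir v ω := by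
  funext x n
  induction n generalizing ω x with
  | zero => rfl
  | succ n ih => simp only [directed, dir, h, ih]

theorem dir_one (ω : ℕ → ZMod 3) (x : Boundary) : dir (false, false) ω x = x := by
  funext n
  induction n generalizing ω x with
  | zero => rfl
  | succ n ih =>
    have h : Klein.flip (false, false) (ω 0) = false := by
      generalize ω 0 = i
      revert i; decide
    simp [dir, h, ih, shift]

theorem dir_ray (v : Klein) (ω : ℕ → ZMod 3) : dir v ω ray = ray := by
  funext n
  induction n generalizing ω with
  | zero => rfl
  | succ n ih => exact ih (shift ω)

theorem Klein.mul_self (v : Klein) : v.mul v = (false, false) := by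
  revert v; decide

theorem dir_eq_ray_iff (v : Klein) (ω : ℕ → ZMod 3) (x : Boundary) :
    dir v ω x = ray ↔ x = ray := by
  refine ⟨fun h => ?_, fun h => h ▸ dir_ray v ω⟩
  rw [← dir_one ω x, ← Klein.mul_self v, ← dir_dir, h, dir_ray]

theorem eq_ray_iff (x : Boundary) : x = ray ↔ x 0 = true ∧ shift x = ray := by
  refine ⟨fun h => ?_, fun ⟨h0, h1⟩ => ?_⟩
  · subst h
    exact ⟨rfl, rfl⟩
  funext n
  cases n with
  | zero => exact h0
  | succ n => exact congrFun h1 n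

/-! ### Words acting on `∂T × F` -/

/-- The ray obtained by prepending a letter. -/
def prepend (i : Bool) (x : Boundary) : Boundary
  | 0 => i
  | n + 1 => x n

theorem prepend_head_shift (x : Boundary) : prepend (x 0) (shift x) = x := by
  funext n; cases n <;> rfl

theorem shift_prepend (i : Bool) (x : Boundary) : shift (prepend i x) = x := rfl

section Action

variable {F : Type*}

/-- The action of `a`. -/
def actA (y : Boundary × F) : Boundary × F := (rootFlip y.1, y.2)

/-- The map with root permutation `ε` and the given sections below `0` and `1`. -/
def join (ε : Bool) (g₀ g₁ : Boundary × F → Boundary × F) (y : Boundary × F) : Boundary × F :=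
  (prepend (xor (y.1 0) ε) ((bif y.1 0 then g₁ else g₀) (shift y.1, y.2)).1,
    ((bif y.1 0 then g₁ else g₀) (shift y.1, y.2)).2)

theorem actA_eq_join : (actA : Boundary × F → Boundary × F) = join true id id := by
  funext y
  refine Prod.ext (funext fun n => ?_) (by cases h : y.1 0 <;> simp [actA, join, h])
  cases n with
  | zero => cases h : y.1 0 <;> simp [actA, join, prepend, rootFlip, h]
  | succ n => cases h : y.1 0 <;> simp [actA, join, prepend, rootFlip, shift, h]

theorem join_comp_join (ε δ : Bool) (g₀ g₁ h₀ h₁ : Boundary × F → Boundary × F) :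
    join ε g₀ g₁ ∘ join δ h₀ h₁ =
      join (xor ε δ) ((bif δ then g₁ else g₀) ∘ h₀) ((bif δ then g₀ else g₁) ∘ h₁) := by
  funext y
  cases hy : y.1 0 <;> cases δ <;> cases ε <;> simp [join, hy, prepend, shift_prepend]

variable [Group F]

open Classical in
/-- The action of `φ_f v`. -/
noncomputable def actH (ω : ℕ → ZMod 3) (h : F × Klein) (y : Boundary × F) : Boundary × F :=
  (dir h.2 ω y.1, if y.1 = ray then h.1 * y.2 else y.2)

/-- The multiplication of the group of pairs `φ_f v`. -/
def mulH (g h : F × Klein) : F × Klein := (g.1 * h.1, g.2.mul h.2)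

/-- The identity among the pairs `φ_f v`. -/
def oneH : F × Klein := (1, (false, false))

/-- Directed automorphisms fix `ρ`, so they commute with every `φ_f`. Adjacent syllables thus merge
into one. -/
theorem actH_mulH (ω : ℕ → ZMod 3) (g h : F × Klein) :
    actH ω (mulH g h) = actH ω g ∘ actH ω h := by
  funext y
  by_cases hy : y.1 = ray <;>
    simp [actH, mulH, dir_dir, dir_eq_ray_iff, hy, mul_assoc]

theorem actH_oneH (ω : ℕ → ZMod 3) : actH ω (oneH : F × Klein) = id := by
  funext y
  simp [actH, oneH, dir_one]

theorem actH_eq_join (ω : ℕ → ZMod 3) (h : F × Klein) :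
    actH ω h = join false (bif h.2.flip (ω 0) then actA else id) (actH (shift ω) h) := by
  funext y
  refine Prod.ext ?_ ?_
  · rw [show (actH ω h y).1 = dir h.2 ω y.1 from rfl,
      ← prepend_head_shift (dir h.2 ω y.1), shift_dir]
    cases hy : y.1 0 <;> cases h.2.flip (ω 0) <;> simp [actA, actH, join, dir, hy]
  · have hray := eq_ray_iff y.1
    cases hy : y.1 0 with
    | false =>
      have : y.1 ≠ ray := fun e => by simp [hray.1 e] at hy
      cases hf : h.2.flip (ω 0) <;> simp [actA, actH, join, this, hy]
    | true =>
      by_cases hs : shift y.1 = ray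
      · simp [actH, join, hray.2 ⟨hy, hs⟩, show ray 0 = true from rfl, show shift ray = ray from rfl]
      · have : y.1 ≠ ray := fun e => hs (hray.1 e).2
        simp [actH, join, this, hs, hy]

/-- The word `h₀ a h₁ a ⋯ a h_k` is encoded by `h₀` and the list `h₁, …, h_k`. -/
noncomputable def eval (ω : ℕ → ZMod 3) : F × Klein → List (F × Klein) → Boundary × F → Boundary × F
  | h, [] => actH ω h
  | h, g :: l => actH ω h ∘ actA ∘ eval ω g l

theorem eval_mulH (ω : ℕ → ZMod 3) (g h : F × Klein) (l : List (F × Klein)) :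
    eval ω (mulH g h) l = actH ω g ∘ eval ω h l := by
  cases l <;> simp [eval, actH_mulH, Function.comp_assoc]

theorem eval_oneH_cons (ω : ℕ → ZMod 3) (h : F × Klein) (l : List (F × Klein)) :
    eval ω oneH (h :: l) = actA ∘ eval ω h l := by
  simp [eval, actH_oneH]

end Action

/-! ### Weights -/

/-- The weight of an element of the Klein group in the phase `s`. -/
noncomputable def wt (W₀ W₁ : ℝ) (s : ZMod 3) (v : Klein) : ℝ :=
  (bif v.flip s then W₁ else 0) + (bif v.flip (s + 1) then W₀ else 0)

theorem wt_nonneg {W₀ W₁ : ℝ} (h₀ : 0 ≤ W₀) (h₁ : 0 ≤ W₁) (s : ZMod 3) (v : Klein) :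
    0 ≤ wt W₀ W₁ s v := by
  unfold wt
  cases v.flip s <;> cases v.flip (s + 1) <;> simp <;> positivity

theorem wt_le {W₀ W₁ : ℝ} (h₀ : 0 ≤ W₀) (h₁ : 0 ≤ W₁) (s : ZMod 3) (v : Klein) :
    wt W₀ W₁ s v ≤ W₀ + W₁ := by
  unfold wt
  cases v.flip s <;> cases v.flip (s + 1) <;> simp <;> linarith

theorem wt_one (W₀ W₁ : ℝ) (s : ZMod 3) : wt W₀ W₁ s (false, false) = 0 := by
  have h : ∀ i, Klein.flip (false, false) i = false := by decide
  simp [wt, h]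

/-- Each table entry is a homomorphism to `Z/2`. This subadditivity is why merging syllables never
increases the weight of a word. -/
theorem wt_mul_le {W₀ W₁ : ℝ} (h₀ : 0 ≤ W₀) (h₁ : 0 ≤ W₁) (s : ZMod 3) (v w : Klein) :
    wt W₀ W₁ s (v.mul w) ≤ wt W₀ W₁ s v + wt W₀ W₁ s w := by
  unfold wt
  rw [Klein.flip_mul, Klein.flip_mul]
  cases v.flip s <;> cases v.flip (s + 1) <;> cases w.flip s <;> cases w.flip (s + 1) <;>
    simp <;> linarith

/-- The weight of a word. -/
noncomputable def weight {F : Type*} (W₀ W₁ : ℝ) (s : ZMod 3) (h : F × Klein)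
    (l : List (F × Klein)) : ℝ :=
  wt W₀ W₁ s h.2 + (l.map fun g => 1 + wt W₀ W₁ s g.2).sum

theorem length_le_weight {F : Type*} {W₀ W₁ : ℝ} (h₀ : 0 ≤ W₀) (h₁ : 0 ≤ W₁) (s : ZMod 3)
    (h : F × Klein) (l : List (F × Klein)) : (l.length : ℝ) ≤ weight W₀ W₁ s h l := by
  have key : (l.length : ℝ) ≤ (l.map fun g => 1 + wt W₀ W₁ s g.2).sum := by
    induction l with
    | nil => simp
    | cons g l ih =>
      have := wt_nonneg h₀ h₁ s g.2
      simp only [List.length_cons, List.map_cons, List.sum_cons]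
      push_cast
      linarith
  have := wt_nonneg h₀ h₁ s h.2
  unfold weight
  linarith

/-- Passing from phase `s` to phase `t` contracts weights by the factor `c`. -/
def Contracts (W₀ W₁ c : ℝ) (s t : ZMod 3) : Prop :=
  ∀ v : Klein, (bif v.flip s then (1 : ℝ) else 0) + wt W₀ W₁ t v ≤ c * (1 + wt W₀ W₁ s v)

theorem contracts_stall (W₀ W₁ : ℝ) (s : ZMod 3) : Contracts W₀ W₁ 1 s s := by
  intro v
  cases v.flip s <;> simp

/-- The three equations are the equality cases for the three nontrivial `v`; the trivial one only
needs `0 ≤ η`. -/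
theorem contracts_rotation {W₀ W₁ η : ℝ} (hη : 0 ≤ η) (e₁ : W₁ + W₀ = η * (1 + W₀))
    (e₂ : 1 + W₀ = η * (1 + W₁)) (e₃ : 1 + W₁ = η * (1 + (W₁ + W₀))) (s : ZMod 3) :
    Contracts W₀ W₁ η s (s + 1) := by
  intro v
  unfold wt
  rw [Klein.flip_add_two]
  cases v.flip s <;> cases v.flip (s + 1) <;> simp <;> linarith

/-- Each syllable `φ_f v` gives `φ_f v_{σω}` to one section and `a` or nothing to the other, which
`Contracts` bounds by `c` times the cost of the syllable together with one `a`. The `+ 1` appears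
because a word has one more syllable than letters `a`. -/
theorem exists_sections {F : Type*} [Group F] {W₀ W₁ c : ℝ} (h₀ : 0 ≤ W₀) (h₁ : 0 ≤ W₁)
    {ω : ℕ → ZMod 3} (hc : Contracts W₀ W₁ c (ω 0) (ω 1)) (h : F × Klein)
    (l : List (F × Klein)) :
    ∃ (ε : Bool) (k₀ k₁ : F × Klein) (l₀ l₁ : List (F × Klein)),
      eval ω h l = join ε (eval (shift ω) k₀ l₀) (eval (shift ω) k₁ l₁) ∧
      weight W₀ W₁ (ω 1) k₀ l₀ + weight W₀ W₁ (ω 1) k₁ l₁ ≤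
        c * (weight W₀ W₁ (ω 0) h l + 1) := by
  have left_mul : ∀ (h k₀ k₁ : F × Klein) (l₀ l₁ : List (F × Klein)),
      ∃ (k₀' k₁' : F × Klein) (l₀' l₁' : List (F × Klein)),
        eval (shift ω) k₀' l₀' =
          (bif h.2.flip (ω 0) then actA else id) ∘ eval (shift ω) k₀ l₀ ∧
        eval (shift ω) k₁' l₁' = actH (shift ω) h ∘ eval (shift ω) k₁ l₁ ∧
        weight W₀ W₁ (ω 1) k₀' l₀' + weight W₀ W₁ (ω 1) k₁' l₁' ≤
          weight W₀ W₁ (ω 1) k₀ l₀ + weight W₀ W₁ (ω 1) k₁ l₁ +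
            c * (1 + wt W₀ W₁ (ω 0) h.2) := by
    intro h k₀ k₁ l₀ l₁
    have hw := wt_mul_le h₀ h₁ (ω 1) h.2 k₁.2
    have hcv := hc h.2
    cases hf : h.2.flip (ω 0) with
    | false =>
      refine ⟨k₀, mulH h k₁, l₀, l₁, by simp, eval_mulH _ _ _ _, ?_⟩
      simp only [hf, cond_false] at hcv
      simp only [weight, mulH]
      linarith
    | true =>
      refine ⟨oneH, mulH h k₁, k₀ :: l₀, l₁, by simp [eval_oneH_cons], eval_mulH _ _ _ _, ?_⟩
      simp only [hf, cond_true] at hcv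
      simp only [weight, mulH, oneH, wt_one, List.map_cons, List.sum_cons]
      linarith
  induction l generalizing h with
  | nil =>
    obtain ⟨k₀, k₁, l₀, l₁, e₀, e₁, hw⟩ := left_mul h oneH oneH [] []
    refine ⟨false, k₀, k₁, l₀, l₁, ?_, ?_⟩
    · rw [e₀, e₁, eval, actH_eq_join]
      simp [eval, actH_oneH]
    · simp only [weight, oneH, wt_one, List.map_nil, List.sum_nil] at hw ⊢
      linarith
  | cons g l ih =>
    obtain ⟨ε, k₀, k₁, l₀, l₁, e, hw⟩ := ih g
    have key : eval ω h (g :: l) =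
        join (!ε) ((bif ε then bif h.2.flip (ω 0) then actA else id else actH (shift ω) h) ∘
          eval (shift ω) k₀ l₀) ((bif ε then actH (shift ω) h else
            bif h.2.flip (ω 0) then actA else id) ∘ eval (shift ω) k₁ l₁) := by
      rw [eval, e, actH_eq_join, actA_eq_join, join_comp_join, join_comp_join]
      cases ε <;> rfl
    have hgl : weight W₀ W₁ (ω 0) h (g :: l) =
        wt W₀ W₁ (ω 0) h.2 + 1 + weight W₀ W₁ (ω 0) g l := by
      simp only [weight, List.map_cons, List.sum_cons]
      ring
    -- The extra `a` exchanges the subtrees, so the syllable `h` extends section `0` or `1`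
    -- according to the root permutation `ε` of the remaining word.
    cases ε with
    | false =>
      obtain ⟨k₁', k₀', l₁', l₀', e₁, e₀, hw'⟩ := left_mul h k₁ k₀ l₁ l₀
      refine ⟨true, k₀', k₁', l₀', l₁', ?_, ?_⟩
      · rw [e₀, e₁, key]
        rfl
      · rw [hgl]
        linarith
    | true =>
      obtain ⟨k₀', k₁', l₀', l₁', e₀, e₁, hw'⟩ := left_mul h k₀ k₁ l₀ l₁
      refine ⟨false, k₀', k₁', l₀', l₁', ?_, ?_⟩
      · rw [e₀, e₁, key]
        rfl
      · rw [hgl]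
        linarith

/-! ### Rotation steps -/

theorem rotSteps_succ (ω : ℕ → ZMod 3) (n : ℕ) :
    rotSteps ω 0 (n + 1) = (if ω 1 = ω 0 + 1 then 1 else 0) + rotSteps (shift ω) 0 n := by
  simp only [rotSteps, Finset.card_filter, zero_add, Nat.Ico_zero_eq_range]
  rw [Finset.sum_range_succ', add_comm]
  rfl

theorem rotSteps_add (ω : ℕ → ZMod 3) (n p : ℕ) :
    rotSteps ω 0 (n + p) = rotSteps ω 0 n + rotSteps ω n p := by
  simp only [rotSteps, Finset.card_filter, zero_add]
  exact (Finset.sum_Ico_consecutive _ (Nat.zero_le n) (Nat.le_add_right n p)).symm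

theorem rotSteps_zero (ω : ℕ → ZMod 3) : rotSteps ω 0 0 = 0 := by simp [rotSteps]

theorem IsRotating.shift {ω : ℕ → ZMod 3} (h : IsRotating ω) : IsRotating (shift ω) :=
  fun i => h (i + 1)

theorem rotSteps_periodic {ω : ℕ → ZMod 3} {p : ℕ} (h : ∀ i, ω (i + p) = ω i) (i : ℕ) :
    rotSteps ω i p = rotSteps ω 0 p := by
  have h₁ := rotSteps_add ω i p
  have h₂ := rotSteps_add ω p i
  have h₃ : rotSteps ω p i = rotSteps ω 0 i := by
    simp only [rotSteps, Finset.card_filter, zero_add, Finset.sum_Ico_eq_sum_range]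
    simp only [add_tsub_cancel_left, tsub_zero]
    refine Finset.sum_congr rfl fun j _ => ?_
    -- Counting the steps on `[0, i + p]` with the cut at `i` and at `p` gives the claim, once the
    -- block starting at `p` is shifted back to `0`.
    rw [add_comm p j, h, show j + p + 1 = j + 1 + p by ring, h]
  rw [add_comm p i] at h₂
  omega

/-- Rotation steps of density at least `lam` occur up to levels that are at most `P` apart. -/
theorem exists_level {ω : ℕ → ZMod 3} {P : ℕ} {lam : ℝ}
    (h : ∀ i, ∃ p, 1 ≤ p ∧ p ≤ P ∧ lam ≤ (rotSteps ω i p : ℝ) / (p : ℝ)) (k : ℕ) :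
    ∃ n, k ≤ n ∧ n < k + P ∧ lam * n ≤ rotSteps ω 0 n := by
  induction k with
  | zero =>
    obtain ⟨p, hp, hP, -⟩ := h 0
    exact ⟨0, le_rfl, by omega, by simp [rotSteps_zero]⟩
  | succ k ih =>
    obtain ⟨n, h₁, h₂, h₃⟩ := ih
    -- A level beyond `k` still serves for `k + 1`; a level equal to `k` is replaced by the end of
    -- the dense block starting there.
    rcases h₁.lt_or_eq with hn | rfl
    · exact ⟨n, hn, by omega, h₃⟩
    · obtain ⟨p, hp, hP, hl⟩ := h k
      refine ⟨k + p, by omega, by omega, ?_⟩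
      rw [le_div_iff₀ (by exact_mod_cast hp)] at hl
      rw [rotSteps_add]
      push_cast
      linarith

/-! ### Coding elements by their sections -/

section Coding

variable {F : Type*} [Group F]

/-- Read a word up to its end mark; return its action and the remaining symbols. -/
noncomputable def parseWord (ω : ℕ → ZMod 3) : List (Bool × (F × Klein)) →
    (Boundary × F → Boundary × F) × List (Bool × (F × Klein))
  | [] => (id, [])
  | (false, h) :: r => (actH ω h, r)
  | (true, h) :: r => (actH ω h ∘ actA ∘ (parseWord ω r).1, (parseWord ω r).2)

/-- Read the action on the first `n` levels together with the sections on level `n`; return the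
action and the remaining symbols. -/
noncomputable def parse : ℕ → (ℕ → ZMod 3) → List (Bool × (F × Klein)) →
    (Boundary × F → Boundary × F) × List (Bool × (F × Klein))
  | 0, ω, r => parseWord ω r
  | _ + 1, _, [] => (id, [])
  -- At a branching vertex only the Boolean matters; the other component is filler that keeps a
  -- single alphabet.
  | n + 1, ω, (ε, _) :: r =>
    (join ε (parse n (shift ω) r).1 (parse n (shift ω) (parse n (shift ω) r).2).1,
      (parse n (shift ω) (parse n (shift ω) r).2).2)

theorem exists_code_word (ω : ℕ → ZMod 3) (h : F × Klein) (l : List (F × Klein)) :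
    ∃ c : List (Bool × (F × Klein)), c.length = l.length + 1 ∧
      ∀ r, parseWord ω (c ++ r) = (eval ω h l, r) := by
  induction l generalizing h with
  | nil => exact ⟨[(false, h)], rfl, fun r => rfl⟩
  | cons g l ih =>
    obtain ⟨c, hc, e⟩ := ih g
    refine ⟨(true, h) :: c, by simp [hc], fun r => ?_⟩
    rw [List.cons_append, parseWord, e, eval]

/-- The code is self-delimiting, hence the arbitrary tail `r`: the codes of the two sections can be
concatenated. The overhead `u n = 3 * 2 ^ n - 2` solves `u (n + 1) = 2 * u n + 2`, `u 0 = 1`: one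
symbol for the root permutation, and at most one from the `+ 1` in `exists_sections`. -/
theorem exists_code {W₀ W₁ η : ℝ} (h₀ : 0 ≤ W₀) (h₁ : 0 ≤ W₁) (hη : 0 ≤ η) (hη1 : η ≤ 1)
    (hc : ∀ s, Contracts W₀ W₁ η s (s + 1)) (n : ℕ) {ω : ℕ → ZMod 3} (hω : IsRotating ω)
    (h : F × Klein) (l : List (F × Klein)) :
    ∃ c : List (Bool × (F × Klein)),
      (c.length : ℝ) ≤ η ^ rotSteps ω 0 n * weight W₀ W₁ (ω 0) h l + (3 * 2 ^ n - 2) ∧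
      ∀ r, parse n ω (c ++ r) = (eval ω h l, r) := by
  induction n generalizing ω h l with
  | zero =>
    obtain ⟨c, hc, e⟩ := exists_code_word ω h l
    refine ⟨c, ?_, e⟩
    have := length_le_weight h₀ h₁ (ω 0) h l
    rw [hc, rotSteps_zero]
    push_cast
    linarith
  | succ n ih =>
    obtain ⟨κ, hκ, hκ0, hκ1, hs⟩ : ∃ κ : ℝ, Contracts W₀ W₁ κ (ω 0) (ω 1) ∧ 0 ≤ κ ∧ κ ≤ 1 ∧
        η ^ rotSteps ω 0 (n + 1) = κ * η ^ rotSteps (shift ω) 0 n := by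
      rw [rotSteps_succ, pow_add]
      by_cases hr : ω 1 = ω 0 + 1
      · exact ⟨η, hr ▸ hc (ω 0), hη, hη1, by simp [hr]⟩
      · have : ω 1 = ω 0 := (hω 0).resolve_right hr
        exact ⟨1, this ▸ contracts_stall W₀ W₁ _, zero_le_one, le_rfl, by simp [hr]⟩
    obtain ⟨ε, k₀, k₁, l₀, l₁, e, hw⟩ := exists_sections h₀ h₁ hκ h l
    obtain ⟨c₀, hc₀, e₀⟩ := ih hω.shift k₀ l₀
    obtain ⟨c₁, hc₁, e₁⟩ := ih hω.shift k₁ l₁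
    refine ⟨(ε, h) :: (c₀ ++ c₁), ?_, fun r => ?_⟩
    · have hq0 : 0 ≤ η ^ rotSteps (shift ω) 0 n := pow_nonneg hη _
      have hq1 : η ^ rotSteps (shift ω) 0 n ≤ 1 := pow_le_one₀ hη hη1
      have h2 := mul_le_mul_of_nonneg_left hw hq0
      have h3 : κ * η ^ rotSteps (shift ω) 0 n ≤ 1 := mul_le_one₀ hκ1 hq0 hq1
      change _ ≤ _ * weight W₀ W₁ (ω 1) k₀ l₀ + _ at hc₀
      change _ ≤ _ * weight W₀ W₁ (ω 1) k₁ l₁ + _ at hc₁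
      rw [hs, List.length_cons, List.length_append, pow_succ]
      push_cast
      linarith
    · rw [List.cons_append, List.append_assoc, parse, e₀, e₁, e]

end Coding

/-! ### The faithful action of `Γ_ω` on `∂T × F` -/

section Representation

variable {F : Type*} [Group F] {ω : ℕ → ZMod 3}

open Classical in
/-- The extension by `1` of a function on the orbit of `ρ`. -/
noncomputable def extend (φ : finSupp (X ω) F) (x : Boundary) : F :=
  if h : x ∈ MulAction.orbit (G ω) ray then φ.1 ⟨x, h⟩ else 1

/-- The action of `Γ_ω` on `∂T × F`. -/
noncomputable def rep (γ : Γ F ω) (y : Boundary × F) : Boundary × F :=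
  ((γ.right : Equiv.Perm Boundary) y.1,
    extend γ.left ((γ.right : Equiv.Perm Boundary) y.1) * y.2)

theorem extend_coe (φ : finSupp (X ω) F) (x : X ω) : extend φ x.1 = φ.1 x := by
  simp [extend]

/-- This is the cocycle identity for `extend`. It also holds off the orbit of `ρ`, since `G_ω`
preserves the complement and all factors there are `1`. -/
theorem rep_mul (γ δ : Γ F ω) : rep (γ * δ) = rep γ ∘ rep δ := by
  funext y
  refine Prod.ext rfl ?_
  set x := (δ.right : Equiv.Perm Boundary) y.1 with hx
  have key : extend (γ * δ).left ((γ.right : Equiv.Perm Boundary) x) =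
      extend γ.left ((γ.right : Equiv.Perm Boundary) x) * extend δ.left x := by
    have hgx : (γ.right : Equiv.Perm Boundary) x = γ.right • x := rfl
    by_cases h : x ∈ MulAction.orbit (G ω) ray
    · have e : (γ.right : Equiv.Perm Boundary) x = (γ.right • (⟨x, h⟩ : X ω) : X ω).1 := rfl
      rw [e, extend_coe, extend_coe, show extend δ.left x = δ.left.1 ⟨x, h⟩ from
        extend_coe δ.left ⟨x, h⟩]
      change γ.left.1 _ * δ.left.1 (γ.right⁻¹ • γ.right • _) = _
      rw [inv_smul_smul]
    · have h' : (γ.right : Equiv.Perm Boundary) x ∉ MulAction.orbit (G ω) ray := by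
        rw [hgx]
        exact fun hm => h (by simpa using MulAction.mem_orbit_of_mem_orbit γ.right⁻¹ hm)
      simp [extend, h, h']
  change extend (γ * δ).left ((γ.right : Equiv.Perm Boundary) x) * y.2 =
    extend γ.left ((γ.right : Equiv.Perm Boundary) x) * (extend δ.left x * y.2)
  rw [key, mul_assoc]

theorem rep_injective : Function.Injective (rep : Γ F ω → Boundary × F → Boundary × F) := by
  intro γ δ h
  have hr : γ.right = δ.right := by
    refine Subtype.ext (Equiv.ext fun x => ?_)
    exact congrArg Prod.fst (congrFun h (x, 1))
  refine SemidirectProduct.ext (Subtype.ext (funext fun x => ?_)) hr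
  -- The value of the function at `x` is read off at the preimage of `x`, with second coordinate
  -- `1`.
  have := congrArg Prod.snd (congrFun h ((γ.right : Equiv.Perm Boundary).symm x.1, 1))
  simpa [rep, ← hr, extend_coe] using this

theorem extend_delta (f : F) (x : Boundary) [Decidable (x = ray)] :
    extend (delta ω f) x = if x = ray then f else 1 := by
  by_cases h : x = ray
  · subst h
    have := extend_coe (delta ω f) (basePoint ω)
    simpa [delta, basePoint] using this
  · simp only [h, if_false]
    unfold extend
    split_ifs with hx
    · have : (⟨x, hx⟩ : X ω) ≠ basePoint ω := fun e => h (congrArg Subtype.val e)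
      classical exact Pi.mulSingle_eq_of_ne (M := fun _ : X ω => F) this f
    · rfl

theorem rep_of_directed {γ : Γ F ω} {f : F} {v : Klein} (hl : γ.left = delta ω f)
    (hr : ∀ x, (γ.right : Equiv.Perm Boundary) x = dir v ω x) : rep γ = actH ω (f, v) := by
  classical
  funext y
  by_cases hy : y.1 = ray <;> simp [rep, actH, hl, hr, extend_delta, dir_eq_ray_iff, hy, dir_ray]

theorem rep_one : rep (1 : Γ F ω) = id := by
  funext y
  have : extend (1 : Γ F ω).left y.1 = 1 := by
    unfold extend
    split_ifs <;> rfl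
  simp only [rep, SemidirectProduct.one_right, OneMemClass.coe_one, Equiv.Perm.coe_one, id, this,
    one_mul]

theorem rep_mem_genSet {γ : Γ F ω} (h : γ ∈ genSet F ω) :
    rep γ = actA ∨ ∃ g : F × Klein, rep γ = actH ω g := by
  rcases h with ⟨hl, hr⟩ | ⟨f, hl, hr⟩
  · left
    funext y
    simp [rep, extend, hl, hr, actA, genA]
  · right
    rcases hr with hr | hr | hr | hr
    · exact ⟨(f, (false, false)), rep_of_directed hl fun x => by simp [hr, dir_one]⟩
    · exact ⟨(f, (true, true)), rep_of_directed hl fun x => by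
        rw [hr, ← directed_eq_dir (l := .b) (by decide)]; rfl⟩
    · exact ⟨(f, (true, false)), rep_of_directed hl fun x => by
        rw [hr, ← directed_eq_dir (l := .c) (by decide)]; rfl⟩
    · exact ⟨(f, (false, true)), rep_of_directed hl fun x => by
        rw [hr, ← directed_eq_dir (l := .d) (by decide)]; rfl⟩

theorem exists_word {W₀ W₁ : ℝ} (h₀ : 0 ≤ W₀) (h₁ : 0 ≤ W₁) (hW : W₀ + W₁ ≤ 2) (r : ℕ) {γ : Γ F ω}
    (hγ : γ ∈ genSet F ω ^ r) :
    ∃ (h : F × Klein) (l : List (F × Klein)), rep γ = eval ω h l ∧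
      weight W₀ W₁ (ω 0) h l ≤ 2 * r := by
  induction r generalizing γ with
  | zero =>
    rw [pow_zero, Set.mem_one] at hγ
    exact ⟨oneH, [], by rw [hγ, rep_one, eval, actH_oneH], by simp [weight, oneH, wt_one]⟩
  | succ r ih =>
    rw [pow_succ', Set.mem_mul] at hγ
    obtain ⟨s, hs, δ, hδ, rfl⟩ := hγ
    obtain ⟨h, l, e, hw⟩ := ih hδ
    rcases rep_mem_genSet hs with ha | ⟨g, hg⟩
    · refine ⟨oneH, h :: l, by rw [rep_mul, ha, e, eval_oneH_cons], ?_⟩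
      simp only [weight, oneH, wt_one, List.map_cons, List.sum_cons] at hw ⊢
      push_cast
      linarith
    · refine ⟨mulH g h, l, by rw [rep_mul, hg, e, eval_mulH], ?_⟩
      have h2 := wt_mul_le h₀ h₁ (ω 0) g.2 h.2
      have h3 := wt_le h₀ h₁ (ω 0) g.2
      simp only [weight, mulH] at hw ⊢
      push_cast
      linarith

end Representation

theorem growth_le_pow {F : Type*} [Group F] [Finite F] {W₀ W₁ η : ℝ} (h₀ : 0 ≤ W₀) (h₁ : 0 ≤ W₁)
    (hW : W₀ + W₁ ≤ 2) (hη : 0 ≤ η) (hη1 : η ≤ 1) (hc : ∀ s, Contracts W₀ W₁ η s (s + 1))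
    {ω : ℕ → ZMod 3} (hω : IsRotating ω) (n r M : ℕ)
    (hM : η ^ rotSteps ω 0 n * (2 * r) + (3 * 2 ^ n - 2) < M + 1) :
    growth (genSet F ω) r ≤ (8 * Nat.card F) ^ M := by
  let Λ := Bool × (F × Klein)
  let decode : (Fin M → Λ) → Boundary × F → Boundary × F := fun f => (parse n ω (List.ofFn f)).1
  have hsub : rep '' (genSet F ω ^ r) ⊆ Set.range decode := by
    rintro _ ⟨γ, hγ, rfl⟩
    obtain ⟨h, l, e, hw⟩ := exists_word h₀ h₁ hW r hγ
    obtain ⟨c, hcl, hp⟩ := exists_code h₀ h₁ hη hη1 hc n hω h l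
    have hlen : c.length ≤ M := by
      have := mul_le_mul_of_nonneg_left hw (pow_nonneg hη (rotSteps ω 0 n))
      have : (c.length : ℝ) < ((M + 1 : ℕ) : ℝ) := by
        push_cast
        linarith
      exact Nat.lt_succ_iff.1 (by exact_mod_cast this)
    -- The parser ignores what follows a code, so all codes can be padded to the common length `M`.
    let c' : List Λ := c ++ List.replicate (M - c.length) (false, oneH)
    have hc' : c'.length = M := by simp [c', hlen]
    refine ⟨fun i => c'.get (i.cast hc'.symm), ?_⟩
    have : List.ofFn (fun i : Fin M => c'.get (i.cast hc'.symm)) = c' := by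
      refine List.ext_getElem (by simp [hc']) fun i h₁ h₂ => by simp
    simp only [decode, this, c', hp, e]
  calc growth (genSet F ω) r = (rep '' (genSet F ω ^ r)).ncard :=
        (Set.ncard_image_of_injective _ rep_injective).symm
    _ ≤ (Set.range decode).ncard := Set.ncard_le_ncard hsub (Set.finite_range _)
    _ ≤ Nat.card (Fin M → Λ) := by
        rw [← Set.image_univ, ← Set.ncard_univ]
        exact Set.ncard_image_le Set.finite_univ
    _ = (8 * Nat.card F) ^ M := by
        rw [Nat.card_fun, Nat.card_prod, Nat.card_prod, Nat.card_prod]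
        simp
        ring

/-! ### Choice of the weights and of the level -/

theorem eta_bounds {η : ℝ} (hη : η ^ 3 + η ^ 2 + η - 2 = 0) : 4 / 5 ≤ η ∧ η ≤ 5 / 6 := by
  constructor <;> by_contra! h <;> nlinarith [sq_nonneg η, sq_nonneg (η + 1)]

theorem exists_weights {η : ℝ} (hη : η ^ 3 + η ^ 2 + η - 2 = 0) :
    ∃ W₀ W₁ : ℝ, 0 ≤ W₀ ∧ 0 ≤ W₁ ∧ W₀ + W₁ ≤ 2 ∧ ∀ s, Contracts W₀ W₁ η s (s + 1) := by
  obtain ⟨hl, hu⟩ := eta_bounds hη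
  -- The first equation of `contracts_rotation` is then an identity in `η`; each of the other two
  -- reduces to the cubic.
  exact ⟨η / 2, (1 + η) * (η / 2), by linarith, by nlinarith, by nlinarith,
    contracts_rotation (by linarith) (by ring) (by linarith) (by linarith)⟩

theorem log_growth_le {F : Type*} [Group F] [Finite F] {η : ℝ} (hη : η ^ 3 + η ^ 2 + η - 2 = 0)
    {ω : ℕ → ZMod 3} (hω : IsRotating ω) (n r : ℕ) :
    Real.log (growth (genSet F ω) r) ≤
      Real.log (8 * Nat.card F) * (η ^ rotSteps ω 0 n * (2 * r) + 3 * 2 ^ n) := by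
  obtain ⟨hl, hu⟩ := eta_bounds hη
  obtain ⟨W₀, W₁, h₀, h₁, hW, hc⟩ := exists_weights hη
  set x : ℝ := η ^ rotSteps ω 0 n * (2 * r) + (3 * 2 ^ n - 2) with hx
  have hx0 : 0 ≤ x := by
    have h1 : 0 ≤ η ^ rotSteps ω 0 n * (2 * r) :=
      mul_nonneg (pow_nonneg (by linarith) _) (by positivity)
    have h2 : (1 : ℝ) ≤ 2 ^ n := one_le_pow₀ (by norm_num)
    linarith
  have key := growth_le_pow (F := F) h₀ h₁ hW (by linarith) (by linarith) hc hω n r ⌊x⌋₊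
    (Nat.lt_floor_add_one x)
  have hN : (1 : ℝ) ≤ 8 * Nat.card F := by
    have : (1 : ℝ) ≤ Nat.card F := by exact_mod_cast Nat.card_pos
    linarith
  have hlog : 0 ≤ Real.log (8 * Nat.card F) := Real.log_nonneg hN
  have hfl : (⌊x⌋₊ : ℝ) ≤ x := Nat.floor_le hx0
  have h1 : Real.log (growth (genSet F ω) r) ≤ ⌊x⌋₊ * Real.log (8 * Nat.card F) := by
    rcases Nat.eq_zero_or_pos (growth (genSet F ω) r) with h | h
    · rw [h, Nat.cast_zero, Real.log_zero]
      positivity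
    · rw [← Real.log_pow]
      exact Real.log_le_log (by exact_mod_cast h) (by exact_mod_cast key)
  calc _ ≤ _ := h1
    _ ≤ x * Real.log (8 * Nat.card F) := mul_le_mul_of_nonneg_right hfl hlog
    _ ≤ _ := by
      rw [mul_comm]
      exact mul_le_mul_of_nonneg_left (by linarith) hlog

theorem log_growth_le_rpow {F : Type*} [Group F] [Finite F] {η : ℝ}
    (hη : η ^ 3 + η ^ 2 + η - 2 = 0) {ω : ℕ → ZMod 3} (hω : IsRotating ω) {P : ℕ} {lam : ℝ}
    (hlam : 0 ≤ lam)
    (h : ∀ i, ∃ p, 1 ≤ p ∧ p ≤ P ∧ lam ≤ (rotSteps ω i p : ℝ) / (p : ℝ)) (r : ℕ) :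
    Real.log (growth (genSet F ω) r) ≤
      (2 * max 1 (5 * Real.log (8 * Nat.card F))) ^ P *
        (r : ℝ) ^ (Real.log 2 / (Real.log 2 - lam * Real.log η)) := by
  obtain ⟨hl, hu⟩ := eta_bounds hη
  have hη0 : 0 < η := by linarith
  have hlogη : Real.log η < 0 := Real.log_neg hη0 (by linarith)
  have hlog2 : 0 < Real.log 2 := Real.log_pos (by norm_num)
  set C := max 1 (5 * Real.log (8 * Nat.card F)) with hC
  have hC1 : 1 ≤ C := le_max_left _ _
  rcases Nat.eq_zero_or_pos r with rfl | hr
  · rw [growth, pow_zero, ← Set.singleton_one, Set.ncard_singleton, Nat.cast_one, Real.log_one]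
    exact mul_nonneg (pow_nonneg (by linarith) _) (Real.rpow_nonneg (Nat.cast_nonneg _) _)
  set D := Real.log 2 - lam * Real.log η with hD
  have hD0 : 0 < D := by nlinarith
  set α := Real.log 2 / D with hα
  have hα0 : 0 < α := div_pos hlog2 hD0
  have hr1 : (1 : ℝ) ≤ r := by exact_mod_cast hr
  have hr0 : (0 : ℝ) < r := by linarith
  have hlogr : 0 ≤ Real.log r := Real.log_nonneg hr1
  -- The real level at which both terms balance: `η^(λm) * r = 2^m = r^α`.
  set m := Real.log r / D with hm
  have hm0 : 0 ≤ m := div_nonneg hlogr hD0.le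
  have h2m : (2 : ℝ) ^ m = (r : ℝ) ^ α := by
    rw [Real.rpow_def_of_pos two_pos, Real.rpow_def_of_pos hr0, hm, hα]
    congr 1
    ring
  obtain ⟨n, hn₁, hn₂, hn₃⟩ := exists_level h ⌈m⌉₊
  have hmn : m ≤ n := (Nat.le_ceil m).trans (by exact_mod_cast hn₁)
  have hnm : (n : ℝ) ≤ m + P := by
    have h1 : (n : ℝ) + 1 ≤ ⌈m⌉₊ + P := by exact_mod_cast hn₂
    have h2 := Nat.ceil_lt_add_one hm0
    linarith
  have h2n : (2 : ℝ) ^ n ≤ 2 ^ P * (r : ℝ) ^ α := by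
    rw [← h2m, ← Real.rpow_natCast, ← Real.rpow_natCast, ← Real.rpow_add two_pos]
    exact Real.rpow_le_rpow_of_exponent_le one_le_two (by linarith)
  -- In logarithms: `q ≥ λn` and `log η < 0` reduce this to `log r = m * D ≤ n * D`.
  have hηn : η ^ rotSteps ω 0 n * r ≤ 2 ^ n := by
    have hq : 0 < η ^ rotSteps ω 0 n := pow_pos hη0 _
    rw [← Real.log_le_log_iff (by positivity) (by positivity), Real.log_mul hq.ne' hr0.ne',
      Real.log_pow, Real.log_pow]
    have h1 : Real.log r = m * D := by rw [hm]; field_simp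
    have h2 : m * D ≤ n * D := mul_le_mul_of_nonneg_right hmn hD0.le
    have h3 := mul_le_mul_of_nonpos_right hn₃ hlogη.le
    rw [hD] at h2
    rw [h1, hD]
    linarith
  have hlogN : 0 ≤ Real.log (8 * Nat.card F) := by
    have : (1 : ℝ) ≤ Nat.card F := by exact_mod_cast Nat.card_pos
    exact Real.log_nonneg (by linarith)
  have hP : P ≠ 0 := by
    obtain ⟨p, hp, hp', -⟩ := h 0
    omega
  calc Real.log (growth (genSet F ω) r)
      ≤ Real.log (8 * Nat.card F) * (η ^ rotSteps ω 0 n * (2 * r) + 3 * 2 ^ n) :=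
        log_growth_le hη hω n r
    _ ≤ Real.log (8 * Nat.card F) * (5 * 2 ^ n) :=
        mul_le_mul_of_nonneg_left (by linarith) hlogN
    _ = (5 * Real.log (8 * Nat.card F)) * 2 ^ n := by ring
    _ ≤ C * (2 ^ P * (r : ℝ) ^ α) :=
        mul_le_mul (le_max_right _ _) h2n (by positivity) (by positivity)
    _ ≤ C ^ P * (2 ^ P * (r : ℝ) ^ α) :=
        mul_le_mul_of_nonneg_right (le_self_pow₀ hC1 hP) (by positivity)
    _ = (2 * C) ^ P * (r : ℝ) ^ α := by rw [mul_pow]; ring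

end WreathGrowth

theorem mainTheorem4 (η : ℝ) (hη : η ^ 3 + η ^ 2 + η - 2 = 0) (N : ℕ) :
    ∃ A : ℝ, 0 < A ∧
      ∀ (F : Type*) [Group F] [Finite F], Nat.card F = N →
      ∀ ω : ℕ → ZMod 3, WreathGrowth.IsRotating ω →
        (∀ (P : ℕ) (lam : ℝ), 0 ≤ lam →
          (∀ i : ℕ, ∃ p : ℕ, 1 ≤ p ∧ p ≤ P ∧
            lam ≤ (WreathGrowth.rotSteps ω i p : ℝ) / (p : ℝ)) →
          ∀ r : ℕ,
            Real.log (WreathGrowth.growth (WreathGrowth.genSet F ω) r : ℝ) ≤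
              A ^ P * (r : ℝ) ^ (Real.log 2 / (Real.log 2 - lam * Real.log η))) ∧
        (∀ p : ℕ, 1 ≤ p → (∀ i : ℕ, ω (i + p) = ω i) →
          ∀ r : ℕ,
            Real.log (WreathGrowth.growth (WreathGrowth.genSet F ω) r : ℝ) ≤
              A ^ p * (r : ℝ) ^ (Real.log 2 /
                (Real.log 2 -
                  ((WreathGrowth.rotSteps ω 0 p : ℝ) / (p : ℝ)) * Real.log η))) := by
  refine ⟨2 * max 1 (5 * Real.log (8 * N)), by positivity, ?_⟩
  rintro F _ _ rfl ω hω
  refine ⟨fun P lam hlam h r => WreathGrowth.log_growth_le_rpow hη hω hlam h r,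
    fun p hp hper r => ?_⟩
  -- The periodic case takes `P = p` and `λ = q/p`, since every window of length `p` has the same
  -- number of rotation steps.
  refine WreathGrowth.log_growth_le_rpow hη hω (by positivity) (fun i => ⟨p, hp, le_rfl, ?_⟩) r
  rw [WreathGrowth.rotSteps_periodic hper i]
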